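/- **Setting.** Let $x_0,\dots,x_N$ be planar poses, $x_i=(p_i,\theta_i)$ with $p_i\in\mathbb R^2$ and $\theta_i\in\mathbb R$, along a candidate path $\mathcal U$ (so $N=k+L$ for planning time $k$ and horizon $L$), and let $n=N+1$. Each measured pair of poses $(i,j)$ carries one relative-pose measurement $\ominus x_i\oplus x_j=(R(\theta_i)^{T}(p_j-p_i),\ \theta_j-\theta_i)$ with independent additive zero-mean Gaussian noise of information matrix $\Omega=\mathrm{diag}(\sigma_p^{-2},\sigma_p^{-2},\sigma_\theta^{-2})$, $\sigma_p,\sigma_\theta>0$. Every odometry pair $(i,i+1)$ is measured, and two poses are related by at most one measurement (in one of the two directions). Let $G=(V,E)$ be the simple undirected graph with vertices the $n$ poses and edges the measured pairs, $t(G)$ its number of spanning trees, $\tau(G)=\ln t(G)$, and $\tilde L$ its Laplacian with the $r$-th row and column removed, for an arbitrary $r\in V$. Let $h$ be the stacked noise-free measurement as a function of the unknown poses $X=(x_1,\dots,x_N)$ ($x_0$ being fixed), $H=\partial h/\partial X$ its Jacobian at the given poses, and $I(X)=H^{T}(I_{|E|}\otimes\Omega)H$ the information matrix of the Gaussian posterior;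 let $I_o(X)$ be the information matrix obtained from the odometry measurements alone. The posterior entropy is $$J(\mathcal U)=\tfrac{3N}{2}\ln(2\pi e)+\tfrac12\ln|I(X)^{-1}|.$$ Put $$s_{ST}(\mathcal U)=\tfrac32\tau(G)+\tfrac{n-1}{2}\bigl[\ln|\Omega|-\ln (2\pi e)^3\bigr],\qquad \Psi=\Bigl(\frac{\sigma_\theta}{\sigma_p}\Bigr)^2\max_{i\in V}\sum_{j:\{i,j\}\in E}\|p_i-p_j\|^2 .$$ **Statement.** The matrix $I(X)$ is positive definite, $\ln|I_o(X)|=(n-1)\ln|\Omega|$, and for every $r\in V$ the matrix $\tilde L$ is positive definite with $t(G)=|\tilde L|$. The entropy satisfies $$J(\mathcal U)\le \tfrac{3(n-1)}{2}\ln(2\pi e)-\tfrac12\bigl[3\tau(G)+(n-1)\ln|\Omega|\bigr]=-s_{ST}(\mathcal U)$$ and, for every $r\in V$, $J(\mathcal U)\ge \mathcal{LB}$, where $$\begin{aligned}\mathcal{LB}&=-s_{ST}(\mathcal U)-\tfrac12\ln|\tilde L+\Psi I_{n-1}|+\tfrac12\tau(G)\\&=-s_{ST}(\mathcal U)-\tfrac12\bigl[\ln|\tilde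 L+\Psi I_{n-1}|-\ln|\tilde L|\bigr]\\&=-s_{ST}(\mathcal U)-\tfrac12\ln|I_{n-1}+\Psi\tilde L^{-1}|.\end{aligned}$$ -/

import Mathlib

open Matrix
open scoped Kronecker

namespace PoseSLAM

/-- A planar pose `(p₁, p₂, θ)`: position coordinates `0`, `1` and heading `2`
(the heading is an unwrapped real angle, so that poses can be differentiated). -/
abbrev Pose : Type := Fin 3 → ℝ

noncomputable section

/-- Pose composition `a ⊕ b = (p_a + R(θ_a) p_b, θ_a + θ_b)`. -/
def oplus (a b : Pose) : Pose :=
  ![a 0 + (Real.cos (a 2) * b 0 - Real.sin (a 2) * b 1),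
    a 1 + (Real.sin (a 2) * b 0 + Real.cos (a 2) * b 1),
    a 2 + b 2]

/-- Pose inverse `⊖ a = (-R(θ_a)ᵀ p_a, -θ_a)`. -/
def ominus (a : Pose) : Pose :=
  ![-(Real.cos (a 2) * a 0 + Real.sin (a 2) * a 1),
    -(-Real.sin (a 2) * a 0 + Real.cos (a 2) * a 1),
    -a 2]

/-- The relative pose `⊖ a ⊕ b`, i.e. the pose `b` seen in the frame of `a`. -/
def relPose (a b : Pose) : Pose := oplus (ominus a) b

end

/-- The relative-pose measurements among the poses `x₀, …, x_N`. A pair `(i, j)` in `meas` stands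
for one measurement of `⊖ xᵢ ⊕ xⱼ`. Two poses are related by at most one measurement, and
consecutive poses are related by odometry. -/
structure PoseGraph (N : ℕ) where
  meas : Finset (Fin (N + 1) × Fin (N + 1))
  asymm : ∀ i j, (i, j) ∈ meas → (j, i) ∉ meas
  odometry : ∀ i : Fin N, (i.castSucc, i.succ) ∈ meas

/-- The odometry measurements only: `⊖ xᵢ ⊕ xᵢ₊₁` for `i < N`. -/
def odometryGraph (N : ℕ) : PoseGraph N where
  meas := Finset.univ.image fun i : Fin N => (i.castSucc, i.succ)
  asymm := by
    intro i j h h'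
    simp only [Finset.mem_image, Finset.mem_univ, true_and, Prod.mk.injEq] at h h'
    obtain ⟨a, rfl, rfl⟩ := h
    obtain ⟨b, hb, hb'⟩ := h'
    simp only [Fin.ext_iff, Fin.val_castSucc, Fin.val_succ] at hb hb'
    omega
  odometry := fun i => Finset.mem_image.2 ⟨i, Finset.mem_univ i, rfl⟩

namespace PoseGraph

variable {N : ℕ} (P : PoseGraph N)

/-- The topological graph `G`: simple, undirected, one vertex per pose, one edge per measurement. -/
def graph : SimpleGraph (Fin (N + 1)) where
  Adj i j := (i, j) ∈ P.meas ∨ (j, i) ∈ P.meas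
  symm := ⟨fun _ _ h => h.symm⟩
  loopless := ⟨fun i h => P.asymm i i (h.elim id id) (h.elim id id)⟩

instance : DecidableRel P.graph.Adj := fun i j =>
  inferInstanceAs (Decidable ((i, j) ∈ P.meas ∨ (j, i) ∈ P.meas))

/-- The number `t(G)` of spanning trees. -/
noncomputable def numSpanningTrees : ℕ :=
  Nat.card {T : SimpleGraph (Fin (N + 1)) // T ≤ P.graph ∧ T.IsTree}

noncomputable section

/-- `τ(G) = ln t(G)`. -/
def tau : ℝ := Real.log P.numSpanningTrees

/-- The graph Laplacian with the `r`-th row and column removed. -/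
def reducedLaplacian (r : Fin (N + 1)) : Matrix {i // i ≠ r} {i // i ≠ r} ℝ :=
  (P.graph.lapMatrix ℝ).submatrix Subtype.val Subtype.val

/-- `dist²_max = max_i ∑_{j adjacent to i} ‖p_i - p_j‖²`, with Euclidean distances of positions. -/
def distMaxSq (x : Fin (N + 1) → Pose) : ℝ :=
  Finset.univ.sup' Finset.univ_nonempty fun i : Fin (N + 1) =>
    ∑ j ∈ P.graph.neighborFinset i, ((x i 0 - x j 0) ^ 2 + (x i 1 - x j 1) ^ 2)

/-- `Ψ = ξ² dist²_max` with `ξ = σ_θ / σ_p`. -/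
def Psi (σp σθ : ℝ) (x : Fin (N + 1) → Pose) : ℝ :=
  (σθ / σp) ^ 2 * P.distMaxSq x

/-- The noise-free stacked measurement `h(X)` as a function of the unknown poses
`X = (x₁, …, x_N)`, the pose `x₀` being fixed. -/
def measMap (x₀ : Pose) (X : Fin N × Fin 3 → ℝ) : {e // e ∈ P.meas} × Fin 3 → ℝ :=
  fun q =>
    let y : Fin (N + 1) → Pose := Fin.cons x₀ fun i c => X (i, c)
    relPose (y q.1.1.1) (y q.1.1.2) q.2

/-- The measurement Jacobian `H = ∂h/∂X` at the trajectory `x = (x₀, x₁, …, x_N)`. -/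
def jacobian (x : Fin (N + 1) → Pose) :
    Matrix ({e // e ∈ P.meas} × Fin 3) (Fin N × Fin 3) ℝ :=
  LinearMap.toMatrix'
    (fderiv ℝ (P.measMap (x 0)) (fun q => x q.1.succ q.2)).toLinearMap

end

end PoseGraph

noncomputable section

/-- The information matrix `diag(σ_p⁻², σ_p⁻², σ_θ⁻²)` of one relative-pose measurement. -/
def noiseInfo (σp σθ : ℝ) : Matrix (Fin 3) (Fin 3) ℝ :=
  Matrix.diagonal ![(σp ^ 2)⁻¹, (σp ^ 2)⁻¹, (σθ ^ 2)⁻¹]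

namespace PoseGraph

variable {N : ℕ} (P : PoseGraph N)

/-- The information matrix `Hᵀ Ω H` of the unknown poses; the noises of different measurements are
independent, so `Ω` is block diagonal. -/
def infoMatrix (σp σθ : ℝ) (x : Fin (N + 1) → Pose) : Matrix (Fin N × Fin 3) (Fin N × Fin 3) ℝ :=
  (P.jacobian x)ᵀ * ((1 : Matrix {e // e ∈ P.meas} {e // e ∈ P.meas} ℝ) ⊗ₖ noiseInfo σp σθ) *
    P.jacobian x

/-- The joint entropy `J` of the `3N`-dimensional Gaussian posterior with covariance the inverse
information matrix. -/
def entropy (σp σθ : ℝ) (x : Fin (N + 1) → Pose) : ℝ :=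
  (3 * N : ℝ) / 2 * Real.log (2 * Real.pi * Real.exp 1) +
    1 / 2 * Real.log ((P.infoMatrix σp σθ x)⁻¹).det

/-- The spanning-tree metric; there are `n = N + 1` vertices, so that `N = n - 1`. -/
def sST (σp σθ : ℝ) : ℝ :=
  3 / 2 * P.tau +
    (N : ℝ) / 2 * (Real.log (noiseInfo σp σθ).det - Real.log ((2 * Real.pi * Real.exp 1) ^ 3))

end PoseGraph

end

end PoseSLAM

/-! Rotating each measured position to the world frame is orthogonal and preserves the isotropic
position noise, so no rotations remain in the information matrix. With `A` the position Jacobian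
(`posJacobian`), `B` the `lever` matrix and `L̃` the Laplacian reduced at pose 0, its position block
is `σp⁻² AᵀA = σp⁻² L̃ ⊗ I₂`, and the Schur complement on the headings is `σθ⁻² L̃ + σp⁻² BᵀΠB`,
where `Π` (`colResidual`) projects onto the complement of the columns of `A`. By the matrix-tree
theorem `det I = σp⁻⁴ᴺ t² det(heading block)`.

Everything now follows from `0 ≤ Π ≤ 1` and monotonicity of `det`. Dropping `BᵀΠB` leaves a third
factor `t`, the upper bound on entropy. Replacing it by `BᵀB`, a diagonal matrix bounded by the
maximal squared distance sum, gives `det(L̃ + Ψ)`, the lower bound.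

The root `r` is free because `BᵀΠB`, formed over all `N + 1` headings, has zero row sums: rotating
the whole trajectory changes no measurement. All corank-one principal minors therefore agree. For
odometry alone `A` is square and invertible, so `Π = 0` and `t = 1`. -/

namespace Matrix

/-! ### Monotonicity of determinants, and minors of matrices with zero row sums. -/

variable {n : Type*} [Fintype n] [DecidableEq n]

/-- Each eigenvalue is a Rayleigh quotient `1 + vᵀPv` at a unit eigenvector `v`. -/
theorem PosSemidef.one_le_det_one_add {P : Matrix n n ℝ} (hP : P.PosSemidef) :
    1 ≤ (1 + P).det := by
  have hH : (1 + P).IsHermitian := isHermitian_one.add hP.1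
  rw [hH.det_eq_prod_eigenvalues]
  have key : ∀ i, 1 ≤ hH.eigenvalues i := by
    intro i
    have h1 := hH.eigenvalues_eq i
    have h2 := hP.dotProduct_mulVec_nonneg (hH.eigenvectorBasis i).ofLp
    have h3 : star (hH.eigenvectorBasis i).ofLp ⬝ᵥ (hH.eigenvectorBasis i).ofLp = 1 := by
      have h := hH.eigenvectorBasis.orthonormal.1 i
      have h4 := EuclideanSpace.real_norm_sq_eq (hH.eigenvectorBasis i)
      rw [h] at h4
      simp only [dotProduct, star_trivial]
      rw [← one_pow (M := ℝ) 2, h4]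
      exact Finset.sum_congr rfl fun j _ => (sq _).symm
    rw [h1, add_mulVec, one_mulVec, dotProduct_add, h3]
    simpa using h2
  simpa using Finset.prod_le_prod (s := Finset.univ) (fun i _ => zero_le_one) fun i _ => key i

-- Writing `A = C*C` with `C` invertible, congruence by `C⁻¹` reduces to the case `A = 1`.
open scoped MatrixOrder in
theorem PosDef.det_le_det_add {A B : Matrix n n ℝ} (hA : A.PosDef) (hB : B.PosSemidef) :
    A.det ≤ (A + B).det := by
  obtain ⟨C, rfl⟩ := CStarAlgebra.nonneg_iff_eq_star_mul_self.1 hA.posSemidef.nonneg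
  have hC : IsUnit C.det := by
    have h := hA.det_pos.ne'
    rw [det_mul] at h
    exact (right_ne_zero_of_mul h).isUnit
  have hC' : IsUnit (star C).det := by
    rw [star_eq_conjTranspose, det_conjTranspose]
    exact hC.star
  have h1 : star C * C + B = star C * (1 + (C⁻¹)ᴴ * B * C⁻¹) * C := by
    rw [Matrix.mul_add, Matrix.add_mul, Matrix.mul_one, conjTranspose_nonsing_inv,
      ← star_eq_conjTranspose, Matrix.mul_assoc (star C)⁻¹, mul_nonsing_inv_cancel_left _ _ hC',
      nonsing_inv_mul_cancel_right _ _ hC]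
  have h2 : (star C * (1 + (C⁻¹)ᴴ * B * C⁻¹) * C).det =
      (star C * C).det * (1 + (C⁻¹)ᴴ * B * C⁻¹).det := by
    simp only [det_mul]
    ring
  rw [h1, h2]
  exact le_mul_of_one_le_right hA.det_pos.le (hB.conjTranspose_mul_mul_same _).one_le_det_one_add

/-- The difference of the two entries is the determinant of `M` with row `r` replaced by `e_s -
e_t`, and that matrix still kills the all-ones vector. -/
theorem adjugate_apply_eq_of_mulVec_one {M : Matrix n n ℝ} (h : M *ᵥ 1 = 0) (r s t : n) :
    M.adjugate s r = M.adjugate t r := by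
  rw [adjugate_apply, adjugate_apply, ← sub_eq_zero]
  have h0 : (M.updateRow r (Pi.single s 1 - Pi.single t 1)).det = 0 := by
    have : Nonempty n := ⟨r⟩
    refine exists_mulVec_eq_zero_iff.1 ⟨1, one_ne_zero, funext fun i => ?_⟩
    by_cases hi : i = r
    · subst hi
      simp only [mulVec, updateRow_self]
      rw [sub_dotProduct]
      simp
    · simpa [mulVec, updateRow_ne hi] using congrFun h i
  have h1 := det_updateRow_add M r (Pi.single s 1 - Pi.single t 1) (Pi.single t 1)
  rw [h0, sub_add_cancel, zero_add] at h1
  rw [h1, sub_self]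

theorem det_submatrix_ne_eq_adjugate (M : Matrix n n ℝ) (r : n) :
    (M.submatrix (Subtype.val : {i // i ≠ r} → n) Subtype.val).det = M.adjugate r r := by
  rw [adjugate_apply, twoBlockTriangular_det _ (fun i => i ≠ r)]
  · have h2 : (toSquareBlockProp (M.updateRow r (Pi.single r 1)) fun i => ¬ i ≠ r).det = 1 := by
      have : Unique {i // ¬ i ≠ r} := ⟨⟨⟨r, by simp⟩⟩, fun a => Subtype.ext (not_not.1 a.2)⟩
      rw [det_unique]
      have h3 : (default : {i // ¬ i ≠ r}).1 = r := not_not.1 (default : {i // ¬ i ≠ r}).2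
      simp [toSquareBlockProp, h3]
    rw [h2, mul_one]
    congr 1
    ext i j
    simp [toSquareBlockProp, updateRow_ne i.2]
  · intro i hi j hj
    obtain rfl := not_not.1 hi
    simp [hj]

/-- The principal minors of corank one of a symmetric matrix with zero row sums are all equal. -/
theorem IsSymm.det_submatrix_ne_eq {M : Matrix n n ℝ} (hM : M.IsSymm) (h : M *ᵥ 1 = 0) (r s : n) :
    (M.submatrix (Subtype.val : {i // i ≠ r} → n) Subtype.val).det =
      (M.submatrix (Subtype.val : {i // i ≠ s} → n) Subtype.val).det := by
  rw [det_submatrix_ne_eq_adjugate, det_submatrix_ne_eq_adjugate,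
    adjugate_apply_eq_of_mulVec_one h r r s, ← transpose_apply M.adjugate, adjugate_transpose, hM.eq,
    adjugate_apply_eq_of_mulVec_one h s r s]

end Matrix

/-! ### The matrix-tree theorem, by expansion over parent functions. -/

namespace SimpleGraph

variable {V : Type*} [DecidableEq V] {r : V}

/-- The self-map of `V` fixing `r` and following the parent function `f` elsewhere. -/
def parentMap (f : {i // i ≠ r} → V) (i : V) : V :=
  if h : i ≠ r then f ⟨i, h⟩ else r

theorem parentMap_root (f : {i // i ≠ r} → V) : parentMap f r = r := by
  simp [parentMap]

theorem parentMap_coe (f : {i // i ≠ r} → V) (i : {i // i ≠ r}) : parentMap f i = f i := by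
  simp [parentMap, i.2]

theorem parentMap_injective : Function.Injective (parentMap (r := r)) := fun f g h =>
  funext fun i => by rw [← parentMap_coe f, h, parentMap_coe]

/-- Every vertex reaches `r` under iteration of `F`. -/
def ReachesRoot (r : V) (F : V → V) : Prop := ∀ i, ∃ k, F^[k] i = r

-- Excludes fixed points and 2-cycles away from `r`: if `F^k i = r` then `F^{2k} i = r`, yet `F^{2k}
-- i = i`.
omit [DecidableEq V] in
theorem ReachesRoot.eq_root_of_involutive_at {F : V → V} (hF : ReachesRoot r F) (hr : F r = r)
    {i : V} (hi : F (F i) = i) : i = r := by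
  obtain ⟨k, hk⟩ := hF i
  have h1 : F^[k] (F^[k] i) = i := by
    rw [← Function.iterate_add_apply, ← two_mul, Function.iterate_mul]
    exact Function.iterate_fixed (f := F^[2]) hi k
  rw [← h1, hk, Function.iterate_fixed hr]

/-- The undirected graph of a self-map. -/
def functionalGraph (F : V → V) : SimpleGraph V := fromRel fun a b => F a = b

omit [DecidableEq V] in
theorem ReachesRoot.functionalGraph_connected {F : V → V} (hF : ReachesRoot r F) :
    (functionalGraph F).Connected := by
  have key : ∀ k i, F^[k] i = r → (functionalGraph F).Reachable i r := by
    intro k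
    induction k with
    | zero => rintro i rfl; exact .refl _
    | succ k ih =>
      intro i hi
      refine .trans ?_ (ih (F i) hi)
      by_cases h : i = F i
      · rw [← h]
      · exact Adj.reachable (by simp [functionalGraph, h])
  have : Nonempty V := ⟨r⟩
  refine ⟨fun i j => ?_⟩
  obtain ⟨k, hk⟩ := hF i
  obtain ⟨l, hl⟩ := hF j
  exact (key k i hk).trans (key l j hl).symm

/-- Every edge is `s(i, F i)` for some `i ≠ r`, so there are at most `|V| - 1` edges, the fewest a
connected graph can have. -/
theorem ReachesRoot.functionalGraph_isTree [Fintype V] {F : V → V} (hF : ReachesRoot r F)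
    (hr : F r = r) : (functionalGraph F).IsTree := by
  refine isTree_iff_connected_and_card.2 ⟨hF.functionalGraph_connected,
    le_antisymm ?_ hF.functionalGraph_connected.card_vert_le_card_edgeSet_add_one⟩
  have hsub : (functionalGraph F).edgeSet ⊆
      ((Finset.univ.erase r).image fun i => s(i, F i) : Finset (Sym2 V)) := by
    intro e he
    induction e with | _ a b
    rw [mem_edgeSet, functionalGraph, fromRel_adj] at he
    obtain ⟨hab, h | h⟩ := he
    · have : a ≠ r := by rintro rfl; exact hab (hr.symm.trans h)
      simp only [Finset.coe_image, Set.mem_image]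
      exact ⟨a, by simp [this], by rw [h]⟩
    · have : b ≠ r := by rintro rfl; exact hab (h.symm.trans hr)
      simp only [Finset.coe_image, Set.mem_image]
      exact ⟨b, by simp [this], by rw [h, Sym2.eq_swap]⟩
  have h1 := Set.ncard_le_ncard hsub (Finset.finite_toSet _)
  rw [Set.ncard_coe_finset] at h1
  have h2 := h1.trans Finset.card_image_le
  rw [Finset.card_erase_of_mem (Finset.mem_univ r), Finset.card_univ] at h2
  have h3 : 0 < Fintype.card V := Fintype.card_pos_iff.2 ⟨r⟩
  rw [Nat.card_eq_fintype_card (α := V), Nat.card_coe_set_eq]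
  omega

-- The orientation towards `r` is recovered by induction on the number of steps to `r`: if `F` did
-- not send `i` to `F' i`, it would send `F' i` to `i`, and the induction hypothesis would give `F'`
-- a 2-cycle.
omit [DecidableEq V] in
theorem ReachesRoot.eq_of_functionalGraph_eq {F F' : V → V} (hF' : ReachesRoot r F')
    (hr : F r = r) (hr' : F' r = r) (h : functionalGraph F = functionalGraph F') : F = F' := by
  have key : ∀ k i, F'^[k] i = r → F i = F' i := by
    intro k
    induction k with
    | zero => rintro i rfl; exact hr.trans hr'.symm
    | succ k ih =>
      intro i hi
      by_cases hir : i = r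
      · rw [hir, hr, hr']
      have hne : i ≠ F' i := fun h => hir (hF'.eq_root_of_involutive_at hr' (by rw [← h, ← h]))
      have hadj : (functionalGraph F').Adj i (F' i) := by simp [functionalGraph, hne]
      rw [← h, functionalGraph, fromRel_adj] at hadj
      obtain h1 | h1 := hadj.2
      · exact h1
      · rw [ih (F' i) hi] at h1
        exact absurd (hF'.eq_root_of_involutive_at hr' h1) hir
  funext i
  obtain ⟨k, hk⟩ := hF' i
  exact key k i hk

variable [Fintype V] (G : SimpleGraph V)

-- The bijection is `f ↦ functionalGraph (parentMap f)`. For surjectivity, send each vertex of a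
-- tree to a neighbour nearer to `r`; the resulting connected subgraph is the whole tree, as trees
-- are minimal connected graphs.
variable (r) in
theorem card_parent_functions_eq_card_spanning_trees :
    Nat.card {f : {i // i ≠ r} → V // (∀ i : {i // i ≠ r}, G.Adj i (f i)) ∧ ReachesRoot r (parentMap f)} =
      Nat.card {T : SimpleGraph V // T ≤ G ∧ T.IsTree} := by
  let φ : {f : {i // i ≠ r} → V // (∀ i : {i // i ≠ r}, G.Adj i (f i)) ∧ ReachesRoot r (parentMap f)} →
      {T : SimpleGraph V // T ≤ G ∧ T.IsTree} := fun f =>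
    ⟨functionalGraph (parentMap f.1), by
      intro a b hab
      rw [functionalGraph, fromRel_adj] at hab
      obtain ⟨hab, h | h⟩ := hab
      · have ha : a ≠ r := by rintro rfl; exact hab ((parentMap_root _).symm.trans h)
        rw [← h, parentMap_coe f.1 ⟨a, ha⟩]
        exact f.2.1 ⟨a, ha⟩
      · have hb : b ≠ r := by rintro rfl; exact hab (h.symm.trans (parentMap_root _))
        rw [← h, parentMap_coe f.1 ⟨b, hb⟩]
        exact (f.2.1 ⟨b, hb⟩).symm,
      f.2.2.functionalGraph_isTree (parentMap_root _)⟩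
  refine Nat.card_congr (Equiv.ofBijective φ ⟨fun f g h => ?_, fun T => ?_⟩)
  · exact Subtype.ext <| parentMap_injective <| g.2.2.eq_of_functionalGraph_eq
      (parentMap_root _) (parentMap_root _) (congrArg Subtype.val h)
  · obtain ⟨T, hTG, hT⟩ := T
    have hex : ∀ i : {i // i ≠ r}, ∃ j, T.Adj i j ∧ T.dist j r < T.dist i r := by
      intro i
      obtain ⟨i, hi⟩ := i
      obtain ⟨p, hp⟩ := hT.connected.exists_walk_length_eq_dist i r
      cases p with
      | nil => exact absurd rfl hi
      | cons h q =>
        rw [Walk.length_cons] at hp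
        exact ⟨_, h, hp ▸ Nat.lt_succ_of_le (dist_le q)⟩
    choose f hadj hdist using hex
    have hreach : ReachesRoot r (parentMap f) := by
      intro i
      induction hd : T.dist i r using Nat.strong_induction_on generalizing i with
      | _ d ih =>
        by_cases hi : i = r
        · exact ⟨0, hi⟩
        · obtain ⟨k, hk⟩ := ih _ (hd ▸ hdist ⟨i, hi⟩) _ rfl
          refine ⟨k + 1, ?_⟩
          rw [Function.iterate_succ_apply, parentMap_coe f ⟨i, hi⟩, hk]
    have hle : functionalGraph (parentMap f) ≤ T := by
      intro a b hab
      rw [functionalGraph, fromRel_adj] at hab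
      obtain ⟨hab, h | h⟩ := hab
      · have ha : a ≠ r := by rintro rfl; exact hab ((parentMap_root _).symm.trans h)
        rw [← h, parentMap_coe f ⟨a, ha⟩]
        exact hadj ⟨a, ha⟩
      · have hb : b ≠ r := by rintro rfl; exact hab (h.symm.trans (parentMap_root _))
        rw [← h, parentMap_coe f ⟨b, hb⟩]
        exact (hadj ⟨b, hb⟩).symm
    refine ⟨⟨f, fun i => hTG (hadj i), hreach⟩, Subtype.ext (le_antisymm hle ?_)⟩
    exact (isTree_iff_minimal_connected.1 hT).2 hreach.functionalGraph_connected hle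

/-- The matrix `1 - P` restricted to the non-root vertices, `P` the matrix of a parent function. -/
def parentMatrix (f : {i // i ≠ r} → V) : Matrix {i // i ≠ r} {i // i ≠ r} ℝ :=
  of fun i j => (if i = j then 1 else 0) - if f i = j then 1 else 0

/-- Sorted by the number of steps to `r`, which `f` strictly decreases, the matrix is triangular
with unit diagonal. -/
theorem det_parentMatrix_of_reachesRoot {f : {i // i ≠ r} → V}
    (hf : ReachesRoot r (parentMap f)) : (parentMatrix f).det = 1 := by
  let d : V → ℕ := fun i => Nat.find (hf i)
  have hd : ∀ i : {i // i ≠ r}, d (f i) < d i := by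
    intro i
    have h1 := Nat.find_spec (hf i)
    have h2 : 0 < d i := Nat.pos_of_ne_zero fun h0 => i.2 (by
      change (parentMap f)^[d i] i = r at h1
      rwa [h0] at h1)
    refine lt_of_le_of_lt (Nat.find_min' (hf (f i)) (m := d i - 1) ?_) (by omega)
    rw [← parentMap_coe f i, ← Function.iterate_succ_apply, Nat.succ_eq_add_one,
      Nat.sub_add_cancel h2]
    exact h1
  have hT : (parentMatrix f).BlockTriangular fun i => OrderDual.toDual (d i) := by
    intro i j hij
    have hij : d i < d j := hij
    have h1 : i ≠ j := by rintro rfl; exact lt_irrefl _ hij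
    have h2 : f i ≠ j := fun h => absurd (hd i) (by rw [h]; exact hij.le.not_gt)
    simp [parentMatrix, h1, h2]
  rw [hT.det]
  refine Finset.prod_eq_one fun a _ => ?_
  suffices h : (parentMatrix f).toSquareBlock (fun i => OrderDual.toDual (d i)) a = 1 by
    rw [h, det_one]
  ext ⟨i, hi⟩ ⟨j, hj⟩
  have h2 : f i ≠ j := fun h => (hd i).ne (by
    rw [h]; exact OrderDual.toDual.injective (hj.trans hi.symm))
  simp [toSquareBlock, toSquareBlockProp, parentMatrix, h2, one_apply]

/-- The indicator of the vertices that never reach `r` is a nonzero kernel vector, since `f i`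
belongs to that set exactly when `i` does. -/
theorem det_parentMatrix_of_not_reachesRoot {f : {i // i ≠ r} → V}
    (hf : ¬ ReachesRoot r (parentMap f)) : (parentMatrix f).det = 0 := by
  classical
  rw [ReachesRoot] at hf
  push Not at hf
  obtain ⟨i₀, hi₀⟩ := hf
  let S : V → Prop := fun i => ∀ k, (parentMap f)^[k] i ≠ r
  have hS : ∀ i : {i // i ≠ r}, S (f i) ↔ S i := by
    intro i
    constructor
    · intro h k
      cases k with
      | zero => exact i.2
      | succ k => rw [Function.iterate_succ_apply, parentMap_coe]; exact h k
    · intro h k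
      rw [← parentMap_coe f i, ← Function.iterate_succ_apply]; exact h _
  have hr : ¬ S r := fun h => h 0 rfl
  refine exists_mulVec_eq_zero_iff.1 ⟨fun i => if S i then 1 else 0, fun h => ?_, funext fun i => ?_⟩
  · simpa [show S i₀ from hi₀] using congrFun h ⟨i₀, hi₀ 0⟩
  · have h1 : ∑ j : {i // i ≠ r}, (if f i = j then (1 : ℝ) else 0) * (if S j then 1 else 0) =
        if S (f i) then 1 else 0 := by
      by_cases hfi : f i = r
      · rw [hfi, if_neg hr]
        exact Finset.sum_eq_zero fun j _ => by rw [if_neg (Ne.symm j.2), zero_mul]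
      · rw [Finset.sum_eq_single ⟨f i, hfi⟩]
        · simp
        · intro j _ hj
          rw [if_neg fun h => hj (Subtype.ext h.symm), zero_mul]
        · simp
    simp only [mulVec, dotProduct, parentMatrix, of_apply, sub_mul, Finset.sum_sub_distrib, h1]
    simp only [ite_mul, one_mul, zero_mul, Finset.sum_ite_eq, Finset.mem_univ, if_true, hS,
      sub_self, Pi.zero_apply]

variable (r) in
/-- **Kirchhoff's matrix-tree theorem**. -/
theorem det_lapMatrix_submatrix_ne [DecidableRel G.Adj] :
    ((G.lapMatrix ℝ).submatrix (Subtype.val : {i // i ≠ r} → V) Subtype.val).det =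
      Nat.card {T : SimpleGraph V // T ≤ G ∧ T.IsTree} := by
  classical
  -- Row `i` is the sum of `e_i - e_j` over the neighbours `j`, with `e_r = 0`. Multilinearity in
  -- the rows then chooses one neighbour for each `i`, that is, a parent function.
  have hrow : (G.lapMatrix ℝ).submatrix (Subtype.val : {i // i ≠ r} → V) Subtype.val =
      fun i => ∑ j ∈ G.neighborFinset i.1,
        fun k : {i // i ≠ r} => (if i = k then (1 : ℝ) else 0) - if j = k then 1 else 0 := by
    ext i k
    simp [lapMatrix, degMatrix, adjMatrix_apply, diagonal_apply, Subtype.ext_iff,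
      Finset.sum_apply]
  have h1 := detRowAlternating.toMultilinearMap.map_sum_finset
    (fun (i : {i // i ≠ r}) (j : V) =>
        fun k : {i // i ≠ r} => (if i = k then (1 : ℝ) else 0) - if j = k then 1 else 0)
    (fun i => G.neighborFinset i.1)
  rw [hrow]
  refine h1.trans ?_
  have h2 : ∀ f : {i // i ≠ r} → V, detRowAlternating.toMultilinearMap
      (fun i => fun k : {i // i ≠ r} => (if i = k then (1 : ℝ) else 0) - if f i = k then 1 else 0) =
      if ReachesRoot r (parentMap f) then 1 else 0 := by
    intro f
    split_ifs with h
    · exact det_parentMatrix_of_reachesRoot h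
    · exact det_parentMatrix_of_not_reachesRoot h
  rw [Finset.sum_congr rfl fun f _ => h2 f, ← card_parent_functions_eq_card_spanning_trees r G,
    Finset.sum_boole, Nat.card_eq_fintype_card, Fintype.card_subtype]
  congr 2
  ext f
  simp [Fintype.mem_piFinset]

end SimpleGraph

/-! ### The Jacobian and the information matrix in the world frame. -/

namespace PoseSLAM

theorem relPose_zero (a b : Pose) : relPose a b 0 =
    Real.cos (a 2) * (b 0 - a 0) + Real.sin (a 2) * (b 1 - a 1) := by
  simp [relPose, oplus, ominus]
  ring

theorem relPose_one (a b : Pose) : relPose a b 1 =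
    -Real.sin (a 2) * (b 0 - a 0) + Real.cos (a 2) * (b 1 - a 1) := by
  simp [relPose, oplus, ominus]
  ring

theorem relPose_two (a b : Pose) : relPose a b 2 = b 2 - a 2 := by
  simp [relPose, oplus, ominus]
  ring

namespace PoseGraph

variable {N : ℕ} (P : PoseGraph N)

/-- The signed incidence matrix of the measurements. -/
def incidence : Matrix {e // e ∈ P.meas} (Fin (N + 1)) ℝ :=
  of fun e i => (if e.1.2 = i then 1 else 0) - if e.1.1 = i then 1 else 0

/-- The dependence of the measured positions on the headings, in the world frame. -/
def lever (x : Fin (N + 1) → Pose) : Matrix ({e // e ∈ P.meas} × Fin 2) (Fin (N + 1)) ℝ :=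
  of fun q i => if q.1.1.1 = i then
    ![x q.1.1.2 1 - x q.1.1.1 1, -(x q.1.1.2 0 - x q.1.1.1 0)] q.2 else 0

/-- The coordinate `c` of the pose `i` as a linear function of the unknown poses, up to the
constant `x₀`. -/
noncomputable def poseCoord (i : Fin (N + 1)) (c : Fin 3) : (Fin N × Fin 3 → ℝ) →L[ℝ] ℝ :=
  Fin.cases 0 (fun k => ContinuousLinearMap.proj (k, c)) i

theorem hasFDerivAt_poseCoord (x₀ : Pose) (X : Fin N × Fin 3 → ℝ) (i : Fin (N + 1)) (c : Fin 3) :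
    HasFDerivAt (fun X : Fin N × Fin 3 → ℝ =>
      (Fin.cons x₀ fun i c => X (i, c) : Fin (N + 1) → Pose) i c) (poseCoord i c) X := by
  cases i using Fin.cases with
  | zero => exact hasFDerivAt_const _ _
  | succ k =>
    exact (ContinuousLinearMap.proj (R := ℝ) (φ := fun _ : Fin N × Fin 3 => ℝ) (k, c)).hasFDerivAt

theorem poseCoord_single (i : Fin (N + 1)) (c : Fin 3) (k : Fin N) (a : Fin 3) :
    poseCoord i c (Pi.single (k, a) 1) =
      (if i = k.succ then 1 else 0) * if c = a then 1 else 0 := by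
  cases i using Fin.cases with
  | zero => simp [poseCoord, (Fin.succ_ne_zero k).symm]
  | succ l => simp [poseCoord, Pi.single_apply, Prod.ext_iff, ← ite_and, and_comm]

theorem cons_unknown (x : Fin (N + 1) → Pose) :
    (Fin.cons (x 0) fun i c => x i.succ c : Fin (N + 1) → Pose) = x :=
  Fin.cons_self_tail x

theorem jacobian_apply (x : Fin (N + 1) → Pose) (q : {e // e ∈ P.meas} × Fin 3)
    (p : Fin N × Fin 3) {f' : (Fin N × Fin 3 → ℝ) →L[ℝ] ℝ}
    (hd : DifferentiableAt ℝ (P.measMap (x 0)) fun q => x q.1.succ q.2)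
    (hf : HasFDerivAt (fun X => P.measMap (x 0) X q) f' fun q => x q.1.succ q.2) :
    P.jacobian x q p = f' (Pi.single p 1) := by
  have h := (hasFDerivAt_pi'.1 hd.hasFDerivAt q).unique hf
  rw [← h, jacobian, LinearMap.toMatrix'_apply]
  rfl

theorem hasFDerivAt_measMap_zero (x : Fin (N + 1) → Pose) (e : {e // e ∈ P.meas}) :
    HasFDerivAt (fun X => P.measMap (x 0) X (e, 0))
      ((Real.cos (x e.1.1 2) • (poseCoord e.1.2 0 - poseCoord e.1.1 0) +
        (x e.1.2 0 - x e.1.1 0) • (-Real.sin (x e.1.1 2)) • poseCoord e.1.1 2) +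
       (Real.sin (x e.1.1 2) • (poseCoord e.1.2 1 - poseCoord e.1.1 1) +
        (x e.1.2 1 - x e.1.1 1) • Real.cos (x e.1.1 2) • poseCoord e.1.1 2))
      fun q => x q.1.succ q.2 := by
  have h := fun i c => hasFDerivAt_poseCoord (x 0) (fun q => x q.1.succ q.2) i c
  have := ((h e.1.1 2).cos.mul ((h e.1.2 0).sub (h e.1.1 0))).add
    ((h e.1.1 2).sin.mul ((h e.1.2 1).sub (h e.1.1 1)))
  simp only [Pi.sub_apply, cons_unknown] at this
  refine this.congr_of_eventuallyEq (.of_forall fun X => ?_)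
  exact relPose_zero _ _

theorem hasFDerivAt_measMap_one (x : Fin (N + 1) → Pose) (e : {e // e ∈ P.meas}) :
    HasFDerivAt (fun X => P.measMap (x 0) X (e, 1))
      ((-Real.sin (x e.1.1 2) • (poseCoord e.1.2 0 - poseCoord e.1.1 0) +
        (x e.1.2 0 - x e.1.1 0) • -(Real.cos (x e.1.1 2) • poseCoord e.1.1 2)) +
       (Real.cos (x e.1.1 2) • (poseCoord e.1.2 1 - poseCoord e.1.1 1) +
        (x e.1.2 1 - x e.1.1 1) • (-Real.sin (x e.1.1 2)) • poseCoord e.1.1 2))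
      fun q => x q.1.succ q.2 := by
  have h := fun i c => hasFDerivAt_poseCoord (x 0) (fun q => x q.1.succ q.2) i c
  have := ((h e.1.1 2).sin.neg.mul ((h e.1.2 0).sub (h e.1.1 0))).add
    ((h e.1.1 2).cos.mul ((h e.1.2 1).sub (h e.1.1 1)))
  simp only [Pi.sub_apply, Pi.neg_apply, cons_unknown] at this
  refine this.congr_of_eventuallyEq (.of_forall fun X => ?_)
  exact relPose_one _ _

theorem hasFDerivAt_measMap_two (x : Fin (N + 1) → Pose) (e : {e // e ∈ P.meas}) :
    HasFDerivAt (fun X => P.measMap (x 0) X (e, 2)) (poseCoord e.1.2 2 - poseCoord e.1.1 2)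
      fun q => x q.1.succ q.2 := by
  have h := fun i c => hasFDerivAt_poseCoord (x 0) (fun q => x q.1.succ q.2) i c
  refine ((h e.1.2 2).sub (h e.1.1 2)).congr_of_eventuallyEq (.of_forall fun X => ?_)
  exact relPose_two _ _

theorem differentiableAt_measMap (x : Fin (N + 1) → Pose) :
    DifferentiableAt ℝ (P.measMap (x 0)) fun q => x q.1.succ q.2 := by
  refine differentiableAt_pi.2 fun q => ?_
  obtain ⟨e, c⟩ := q
  fin_cases c
  · exact (P.hasFDerivAt_measMap_zero x e).differentiableAt
  · exact (P.hasFDerivAt_measMap_one x e).differentiableAt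
  · exact (P.hasFDerivAt_measMap_two x e).differentiableAt

/-- The measurement Jacobian with every position measurement rotated to the world frame. -/
def worldJacobian (x : Fin (N + 1) → Pose) (e : {e // e ∈ P.meas}) (k : Fin N) (a : Fin 3) :
    Fin 3 → ℝ :=
  ![P.incidence e k.succ * (if a = 0 then 1 else 0) +
      P.lever x (e, 0) k.succ * (if a = 2 then 1 else 0),
    P.incidence e k.succ * (if a = 1 then 1 else 0) +
      P.lever x (e, 1) k.succ * (if a = 2 then 1 else 0),
    P.incidence e k.succ * (if a = 2 then 1 else 0)]

theorem jacobian_zero (x : Fin (N + 1) → Pose) (e : {e // e ∈ P.meas}) (k : Fin N) (a : Fin 3) :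
    P.jacobian x (e, 0) (k, a) = Real.cos (x e.1.1 2) * P.worldJacobian x e k a 0 +
      Real.sin (x e.1.1 2) * P.worldJacobian x e k a 1 := by
  rw [P.jacobian_apply x _ _ (P.differentiableAt_measMap x) (P.hasFDerivAt_measMap_zero x e)]
  simp only [_root_.add_apply, _root_.smul_apply, _root_.sub_apply, poseCoord_single, smul_eq_mul,
    worldJacobian, incidence, lever, of_apply, cons_val, eq_comm (b := a)]
  split_ifs <;> ring

theorem jacobian_one (x : Fin (N + 1) → Pose) (e : {e // e ∈ P.meas}) (k : Fin N) (a : Fin 3) :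
    P.jacobian x (e, 1) (k, a) = -Real.sin (x e.1.1 2) * P.worldJacobian x e k a 0 +
      Real.cos (x e.1.1 2) * P.worldJacobian x e k a 1 := by
  rw [P.jacobian_apply x _ _ (P.differentiableAt_measMap x) (P.hasFDerivAt_measMap_one x e)]
  simp only [_root_.add_apply, _root_.smul_apply, _root_.sub_apply, _root_.neg_apply,
    poseCoord_single, smul_eq_mul, worldJacobian, incidence, lever, of_apply, cons_val,
    eq_comm (b := a)]
  split_ifs <;> ring

theorem jacobian_two (x : Fin (N + 1) → Pose) (e : {e // e ∈ P.meas}) (k : Fin N) (a : Fin 3) :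
    P.jacobian x (e, 2) (k, a) = P.worldJacobian x e k a 2 := by
  rw [P.jacobian_apply x _ _ (P.differentiableAt_measMap x) (P.hasFDerivAt_measMap_two x e)]
  simp only [_root_.sub_apply,
    poseCoord_single, worldJacobian, incidence, of_apply, cons_val, eq_comm (b := a)]
  split_ifs <;> ring

/-- Both position coordinates carry the same weight, so the heading rotation cancels through `sin² +
cos² = 1`. -/
theorem infoMatrix_apply (σp σθ : ℝ) (x : Fin (N + 1) → Pose) (p q : Fin N × Fin 3) :
    P.infoMatrix σp σθ x p q = ∑ e,
      ((σp ^ 2)⁻¹ * (P.worldJacobian x e p.1 p.2 0 * P.worldJacobian x e q.1 q.2 0 +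
          P.worldJacobian x e p.1 p.2 1 * P.worldJacobian x e q.1 q.2 1) +
        (σθ ^ 2)⁻¹ * (P.worldJacobian x e p.1 p.2 2 * P.worldJacobian x e q.1 q.2 2)) := by
  obtain ⟨k, a⟩ := p
  obtain ⟨l, b⟩ := q
  rw [infoMatrix, noiseInfo, ← diagonal_one, diagonal_kronecker_diagonal, mul_apply,
    Fintype.sum_prod_type]
  refine Finset.sum_congr rfl fun e _ => ?_
  simp only [mul_diagonal, transpose_apply, Fin.sum_univ_three, jacobian_zero, jacobian_one,
    jacobian_two, one_mul, cons_val]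
  linear_combination (σp ^ 2)⁻¹ * (P.worldJacobian x e k a 0 * P.worldJacobian x e l b 0 +
    P.worldJacobian x e k a 1 * P.worldJacobian x e l b 1) *
    Real.sin_sq_add_cos_sq (x e.1.1 2)

end PoseGraph

end PoseSLAM

/-! ### The residual projection of a column space. -/

namespace Matrix

variable {m n : Type*} [Fintype m] [DecidableEq m] [Fintype n] [DecidableEq n]

/-- The orthogonal projection onto the complement of the column space of `A`, for `A` of full
column rank. -/
noncomputable def colResidual (A : Matrix m n ℝ) : Matrix m m ℝ := 1 - A * (Aᵀ * A)⁻¹ * Aᵀ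

theorem colResidual_mul {A : Matrix m n ℝ} (hA : (Aᵀ * A).det ≠ 0) : colResidual A * A = 0 := by
  rw [colResidual, Matrix.sub_mul, Matrix.one_mul, Matrix.mul_assoc, Matrix.mul_assoc,
    nonsing_inv_mul _ hA.isUnit, Matrix.mul_one, sub_self]

theorem colResidual_transpose (A : Matrix m n ℝ) : (colResidual A)ᵀ = colResidual A := by
  simp [colResidual, transpose_nonsing_inv, Matrix.mul_assoc]

theorem colResidual_mul_self {A : Matrix m n ℝ} (hA : (Aᵀ * A).det ≠ 0) :
    colResidual A * colResidual A = colResidual A := by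
  have h : colResidual A * (1 - A * (Aᵀ * A)⁻¹ * Aᵀ) = colResidual A := by
    rw [Matrix.mul_sub, Matrix.mul_one, ← Matrix.mul_assoc, ← Matrix.mul_assoc, colResidual_mul hA,
      Matrix.zero_mul, Matrix.zero_mul, sub_zero]
  exact h

theorem posSemidef_colResidual {A : Matrix m n ℝ} (hA : (Aᵀ * A).det ≠ 0) :
    (colResidual A).PosSemidef := by
  have h := posSemidef_conjTranspose_mul_self (colResidual A)
  rwa [conjTranspose_eq_transpose_of_trivial, colResidual_transpose, colResidual_mul_self hA] at h

/-- No rank condition is needed: if `AᵀA` is singular its inverse is `0` by convention. -/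
theorem posSemidef_one_sub_colResidual (A : Matrix m n ℝ) : (1 - colResidual A).PosSemidef := by
  have h := (posSemidef_conjTranspose_mul_self A).inv.mul_mul_conjTranspose_same A
  simp only [conjTranspose_eq_transpose_of_trivial] at h
  rwa [colResidual, sub_sub_cancel]

end Matrix

/-! ### Block structure of the information matrix and its Schur complement. -/

namespace PoseSLAM.PoseGraph

variable {N : ℕ} (P : PoseGraph N)

theorem sum_meas (g : Fin (N + 1) × Fin (N + 1) → ℝ) : ∑ e : {e // e ∈ P.meas}, g e =
    ∑ a, ∑ b, if (a, b) ∈ P.meas then g (a, b) else 0 := by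
  rw [Finset.sum_coe_sort P.meas g, ← Fintype.sum_prod_type'
    (f := fun a b => if (a, b) ∈ P.meas then g (a, b) else 0)]
  simp

theorem incidence_transpose_mul_self : P.incidenceᵀ * P.incidence = P.graph.lapMatrix ℝ := by
  ext i j
  have hirr : ∀ a, (a, a) ∉ P.meas := fun a h => P.asymm a a h h
  simp only [mul_apply, transpose_apply, incidence, of_apply]
  rw [P.sum_meas fun e => ((if e.2 = i then 1 else 0) - if e.1 = i then 1 else 0) *
    ((if e.2 = j then 1 else 0) - if e.1 = j then 1 else 0)]
  -- The first two terms count the measurements into and out of `i`, giving the degree; the last two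
  -- give the adjacency entry.
  have h1 : ∀ a b, (if (a, b) ∈ P.meas then
      (((if b = i then (1 : ℝ) else 0) - if a = i then 1 else 0) *
        ((if b = j then 1 else 0) - if a = j then 1 else 0)) else 0) =
      (if b = i then if i = j then if (a, i) ∈ P.meas then 1 else 0 else 0 else 0) +
      (if a = i then if i = j then if (i, b) ∈ P.meas then 1 else 0 else 0 else 0) -
      (if b = i then if a = j then if (j, i) ∈ P.meas then 1 else 0 else 0 else 0) -
      (if a = i then if b = j then if (i, j) ∈ P.meas then 1 else 0 else 0 else 0) := by
    intro a b
    by_cases hai : a = i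
    · subst hai
      by_cases hbi : b = a
      · subst hbi
        by_cases hj : b = j <;> simp [hj]
      · by_cases hbj : b = j
        · subst hbj
          simp only [hbi, Ne.symm hbi, if_true, if_false]
          split_ifs <;> norm_num
        · by_cases haj : a = j
          · subst haj
            simp [hbi]
          · simp [hbi, hbj, haj]
    · by_cases hbi : b = i
      · subst hbi
        by_cases haj : a = j
        · subst haj
          simp only [hai, Ne.symm hai, if_true, if_false]
          split_ifs <;> norm_num
        · by_cases hbj : b = j
          · subst hbj
            simp [hai]
          · simp [hai, hbj, haj]
      · simp [hai, hbi]
  have hdeg : (P.graph.degree i : ℝ) =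
      (∑ a, if (a, i) ∈ P.meas then 1 else 0) + ∑ b, if (i, b) ∈ P.meas then 1 else 0 := by
    rw [P.graph.degree_eq_sum_if_adj, ← Finset.sum_add_distrib]
    refine Finset.sum_congr rfl fun b _ => ?_
    by_cases h : (b, i) ∈ P.meas
    · simp [graph, h, P.asymm _ _ h]
    · simp [graph, h]
  simp only [h1, Finset.sum_add_distrib, Finset.sum_sub_distrib]
  rw [SimpleGraph.lapMatrix, SimpleGraph.degMatrix, Matrix.sub_apply, diagonal_apply,
    SimpleGraph.adjMatrix_apply]
  by_cases hij : i = j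
  · subst hij
    simp [hdeg, hirr]
  · by_cases h : (i, j) ∈ P.meas
    · simp [hij, graph, h, P.asymm _ _ h]
    · simp [hij, graph, h]

/-- The blocks of the unknowns: all positions, then all headings. -/
def unknownEquiv (N : ℕ) : (Fin N × Fin 2) ⊕ Fin N ≃ Fin N × Fin 3 where
  toFun := Sum.elim (fun q => (q.1, q.2.castSucc)) fun k => (k, 2)
  invFun q := ![Sum.inl (q.1, 0), Sum.inl (q.1, 1), Sum.inr q.1] q.2
  left_inv q := by
    rcases q with ⟨k, c⟩ | k
    · fin_cases c <;> rfl
    · rfl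
  right_inv q := by
    obtain ⟨k, c⟩ := q
    fin_cases c <;> rfl

/-- The Jacobian of the world-frame position measurements with respect to the positions. -/
def posJacobian : Matrix ({e // e ∈ P.meas} × Fin 2) (Fin N × Fin 2) ℝ :=
  P.incidence.submatrix id Fin.succ ⊗ₖ 1

/-- This is the weighted Gram matrix of `[A B; 0 D]`, with `A`, `B`, `D` the position Jacobian, the
lever and the incidence matrix; `Fin.succ` drops the columns of the fixed pose. -/
theorem infoMatrix_submatrix (σp σθ : ℝ) (x : Fin (N + 1) → Pose) :
    (P.infoMatrix σp σθ x).submatrix (unknownEquiv N) (unknownEquiv N) =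
      fromBlocks ((σp ^ 2)⁻¹ • (P.posJacobianᵀ * P.posJacobian))
        ((σp ^ 2)⁻¹ • (P.posJacobianᵀ * (P.lever x).submatrix id Fin.succ))
        ((σp ^ 2)⁻¹ • (((P.lever x).submatrix id Fin.succ)ᵀ * P.posJacobian))
        ((σp ^ 2)⁻¹ • (((P.lever x).submatrix id Fin.succ)ᵀ * (P.lever x).submatrix id Fin.succ) +
          (σθ ^ 2)⁻¹ • ((P.incidenceᵀ * P.incidence).submatrix Fin.succ Fin.succ)) := by
  ext p q
  rw [submatrix_apply, infoMatrix_apply]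
  rcases p with ⟨k, c⟩ | k <;> rcases q with ⟨l, d⟩ | l
  · fin_cases c <;> fin_cases d <;>
      simp [unknownEquiv, worldJacobian, posJacobian, mul_apply, Fintype.sum_prod_type,
        Finset.mul_sum, one_apply]
  · fin_cases c <;>
      simp [unknownEquiv, worldJacobian, posJacobian, mul_apply, Fintype.sum_prod_type,
        Finset.mul_sum, one_apply]
  · fin_cases d <;>
      simp [unknownEquiv, worldJacobian, posJacobian, mul_apply, Fintype.sum_prod_type,
        Finset.mul_sum, one_apply]
  · simp [unknownEquiv, worldJacobian, mul_apply, Fintype.sum_prod_type,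
        Finset.mul_sum, Finset.sum_add_distrib, mul_add]

theorem posJacobian_transpose_mul_self : P.posJacobianᵀ * P.posJacobian =
    ((P.graph.lapMatrix ℝ).submatrix Fin.succ Fin.succ) ⊗ₖ (1 : Matrix (Fin 2) (Fin 2) ℝ) := by
  rw [posJacobian, ← kroneckerMap_transpose, ← mul_kronecker_mul, ← incidence_transpose_mul_self]
  simp
  rfl

theorem det_submatrix_succ (M : Matrix (Fin (N + 1)) (Fin (N + 1)) ℝ) :
    (M.submatrix Fin.succ Fin.succ).det =
      (M.submatrix (Subtype.val : {i // i ≠ (0 : Fin (N + 1))} → _) Subtype.val).det := by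
  rw [← det_submatrix_equiv_self (finSuccAboveEquiv (0 : Fin (N + 1)))]
  rfl

/-- The headings' information that is not lost to the estimation of the positions. -/
noncomputable def leverInfo (x : Fin (N + 1) → Pose) : Matrix (Fin (N + 1)) (Fin (N + 1)) ℝ :=
  (P.lever x)ᵀ * colResidual P.posJacobian * P.lever x

/-- Schur complement of the position block. The exponent `2 * N` and the square reflect the two
coordinates of each position. -/
theorem det_infoMatrix {σp σθ : ℝ} (hp : 0 < σp) (x : Fin (N + 1) → Pose)
    (h0 : ((P.graph.lapMatrix ℝ).submatrix Fin.succ Fin.succ).det ≠ 0) :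
    (P.infoMatrix σp σθ x).det =
      ((σp ^ 2)⁻¹) ^ (2 * N) * ((P.graph.lapMatrix ℝ).submatrix Fin.succ Fin.succ).det ^ 2 *
        (((σθ ^ 2)⁻¹ • P.graph.lapMatrix ℝ + (σp ^ 2)⁻¹ • P.leverInfo x).submatrix
          Fin.succ Fin.succ).det := by
  have hw : (σp ^ 2)⁻¹ ≠ 0 := by positivity
  have hdet : (P.posJacobianᵀ * P.posJacobian).det =
      ((P.graph.lapMatrix ℝ).submatrix Fin.succ Fin.succ).det ^ 2 := by
    rw [posJacobian_transpose_mul_self, det_kronecker]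
    simp
  have hunit : IsUnit ((σp ^ 2)⁻¹ • (P.posJacobianᵀ * P.posJacobian)).det := by
    rw [det_smul, hdet]
    exact (mul_ne_zero (pow_ne_zero _ hw) (pow_ne_zero _ h0)).isUnit
  have hunit' : IsUnit (P.posJacobianᵀ * P.posJacobian).det := by
    rw [hdet]; exact (pow_ne_zero _ h0).isUnit
  have := invertibleOfIsUnitDet _ hunit
  rw [← det_submatrix_equiv_self (unknownEquiv N), infoMatrix_submatrix, det_fromBlocks₁₁, det_smul,
    hdet, invOf_eq_nonsing_inv]
  congr 2
  · simp [mul_comm]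
  · have hinv : ((σp ^ 2)⁻¹ • (P.posJacobianᵀ * P.posJacobian))⁻¹ =
        (σp ^ 2) • (P.posJacobianᵀ * P.posJacobian)⁻¹ := by
      refine (inv_smul' _ (Units.mk0 _ hw) hunit').trans ?_
      simp [Units.smul_def]
    rw [hinv, incidence_transpose_mul_self]
    have hs : (P.leverInfo x).submatrix Fin.succ Fin.succ =
        ((P.lever x).submatrix id Fin.succ)ᵀ * colResidual P.posJacobian *
          (P.lever x).submatrix id Fin.succ := rfl
    have hs' : ((σθ ^ 2)⁻¹ • P.graph.lapMatrix ℝ + (σp ^ 2)⁻¹ • P.leverInfo x).submatrix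
        Fin.succ Fin.succ = (σθ ^ 2)⁻¹ • (P.graph.lapMatrix ℝ).submatrix Fin.succ Fin.succ +
          (σp ^ 2)⁻¹ • (P.leverInfo x).submatrix Fin.succ Fin.succ := rfl
    rw [hs', hs, colResidual]
    have h2 : σp ^ 2 * (σp ^ 2)⁻¹ = 1 := by field_simp
    simp only [Matrix.smul_mul, Matrix.mul_smul, smul_smul, Matrix.mul_sub, Matrix.sub_mul,
      Matrix.mul_assoc, Matrix.mul_one, smul_sub]
    rw [h2, mul_one]
    abel

end PoseSLAM.PoseGraph

/-! ### Two-sided bounds on the heading information. -/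

namespace PoseSLAM.PoseGraph

variable {N : ℕ} (P : PoseGraph N)

theorem graph_connected : P.graph.Connected := by
  have key : ∀ i, P.graph.Reachable i 0 := by
    intro i
    induction i using Fin.induction with
    | zero => exact .refl _
    | succ i ih =>
      refine .trans (SimpleGraph.Adj.reachable ?_) ih
      exact Or.inr (P.odometry i)
  exact ⟨fun i j => (key i).trans (key j).symm⟩

theorem numSpanningTrees_pos : 0 < P.numSpanningTrees := by
  obtain ⟨T, hT, hT'⟩ := P.graph_connected.exists_isTree_le
  have : Nonempty {T : SimpleGraph (Fin (N + 1)) // T ≤ P.graph ∧ T.IsTree} := ⟨⟨T, hT, hT'⟩⟩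
  exact Nat.card_pos

theorem det_reducedLaplacian (r : Fin (N + 1)) :
    (P.reducedLaplacian r).det = P.numSpanningTrees :=
  P.graph.det_lapMatrix_submatrix_ne r

theorem posDef_reducedLaplacian (r : Fin (N + 1)) : (P.reducedLaplacian r).PosDef := by
  have h : (P.reducedLaplacian r).PosSemidef :=
    (SimpleGraph.posSemidef_lapMatrix ℝ P.graph).submatrix _
  rw [h.posDef_iff_det_ne_zero, det_reducedLaplacian]
  exact_mod_cast P.numSpanningTrees_pos.ne'

theorem det_lapMatrix_submatrix_succ :
    ((P.graph.lapMatrix ℝ).submatrix Fin.succ Fin.succ).det = P.numSpanningTrees := by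
  rw [det_submatrix_succ]
  exact P.det_reducedLaplacian 0

theorem det_posJacobian_transpose_mul_self_ne_zero :
    (P.posJacobianᵀ * P.posJacobian).det ≠ 0 := by
  rw [posJacobian_transpose_mul_self, det_kronecker, det_lapMatrix_submatrix_succ]
  have := P.numSpanningTrees_pos.ne'
  simp [this]

/-- An infinitesimal rotation of the whole trajectory about `p₀` changes no measurement, so the
effect of turning all headings equally is cancelled by a displacement of the positions. -/
theorem lever_mulVec_one (x : Fin (N + 1) → Pose) :
    P.lever x *ᵥ 1 = P.posJacobian *ᵥ fun q =>
      ![x q.1.succ 1 - x 0 1, -(x q.1.succ 0 - x 0 0)] q.2 := by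
  funext ⟨e, c⟩
  let y : Fin (N + 1) → ℝ := fun i => ![x i 1 - x 0 1, -(x i 0 - x 0 0)] c
  -- The displacement vanishes at pose 0, so restoring the dropped incidence column adds nothing.
  have hy : y 0 = 0 := by fin_cases c <;> simp [y]
  have h1 : (P.posJacobian *ᵥ fun q : Fin N × Fin 2 =>
      ![x q.1.succ 1 - x 0 1, -(x q.1.succ 0 - x 0 0)] q.2) (e, c) =
      ∑ i, P.incidence e i * y i := by
    rw [Fin.sum_univ_succ, hy, mul_zero, zero_add]
    simp only [mulVec, dotProduct, Fintype.sum_prod_type, posJacobian, kroneckerMap_apply,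
      submatrix_apply, id, one_apply, mul_ite, mul_one, mul_zero, ite_mul, zero_mul,
      Finset.sum_ite_eq, Finset.mem_univ, if_true]
    rfl
  rw [h1]
  simp only [incidence, of_apply, sub_mul, ite_mul, one_mul, zero_mul, Finset.sum_sub_distrib,
    Finset.sum_ite_eq, Finset.mem_univ, if_true, mulVec, dotProduct, lever, Pi.one_apply, mul_one]
  fin_cases c <;> simp [y]

theorem leverInfo_mulVec_one (x : Fin (N + 1) → Pose) : P.leverInfo x *ᵥ 1 = 0 := by
  rw [leverInfo, ← mulVec_mulVec, lever_mulVec_one, mulVec_mulVec, Matrix.mul_assoc,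
    colResidual_mul P.det_posJacobian_transpose_mul_self_ne_zero, Matrix.mul_zero, zero_mulVec]

theorem posSemidef_leverInfo (x : Fin (N + 1) → Pose) : (P.leverInfo x).PosSemidef := by
  have h := (posSemidef_colResidual
    P.det_posJacobian_transpose_mul_self_ne_zero).conjTranspose_mul_mul_same (P.lever x)
  rwa [conjTranspose_eq_transpose_of_trivial] at h

/-- Diagonal because a row of the lever is supported on the first pose of its measurement, whose
heading defines the frame. -/
theorem lever_transpose_mul_self (x : Fin (N + 1) → Pose) :
    (P.lever x)ᵀ * P.lever x = diagonal fun i => ∑ j, if (i, j) ∈ P.meas then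
      (x i 0 - x j 0) ^ 2 + (x i 1 - x j 1) ^ 2 else 0 := by
  ext i j
  simp only [mul_apply, transpose_apply, lever, of_apply, Fintype.sum_prod_type, Fin.sum_univ_two,
    cons_val]
  rw [P.sum_meas fun e => ((if e.1 = i then x e.2 1 - x e.1 1 else 0) *
      (if e.1 = j then x e.2 1 - x e.1 1 else 0)) +
    ((if e.1 = i then -(x e.2 0 - x e.1 0) else 0) *
      (if e.1 = j then -(x e.2 0 - x e.1 0) else 0)), Finset.sum_eq_single i]
  · by_cases hij : i = j
    · subst hij
      rw [diagonal_apply_eq]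
      refine Finset.sum_congr rfl fun b _ => ?_
      simp only [if_true]
      congr 1
      ring
    · simp [hij]
  · intro a _ ha
    simp [ha]
  · simp

/-- Since `Π ≤ 1`, it suffices to bound `BᵀB`, whose diagonal entry at `i` sums over only those
neighbours that are measured from `i`. -/
theorem posSemidef_distMaxSq_sub_leverInfo (x : Fin (N + 1) → Pose) :
    (P.distMaxSq x • (1 : Matrix _ _ ℝ) - P.leverInfo x).PosSemidef := by
  have h1 : (P.distMaxSq x • (1 : Matrix _ _ ℝ) - (P.lever x)ᵀ * P.lever x).PosSemidef := by
    rw [lever_transpose_mul_self, smul_one_eq_diagonal, diagonal_sub]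
    refine PosSemidef.diagonal fun i => sub_nonneg.2 ?_
    refine le_trans ?_ (Finset.le_sup' (fun i : Fin (N + 1) =>
      ∑ j ∈ P.graph.neighborFinset i, ((x i 0 - x j 0) ^ 2 + (x i 1 - x j 1) ^ 2))
      (Finset.mem_univ i))
    rw [← Finset.sum_filter]
    refine Finset.sum_le_sum_of_subset_of_nonneg (fun j hj => ?_) fun _ _ _ => by positivity
    rw [SimpleGraph.mem_neighborFinset]
    exact Or.inl (Finset.mem_filter.1 hj).2
  have h2 := (posSemidef_one_sub_colResidual P.posJacobian).conjTranspose_mul_mul_same (P.lever x)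
  rw [conjTranspose_eq_transpose_of_trivial] at h2
  convert h1.add h2 using 1
  rw [leverInfo, Matrix.mul_sub, Matrix.sub_mul, Matrix.mul_one]
  abel

theorem Psi_nonneg (σp σθ : ℝ) (x : Fin (N + 1) → Pose) : 0 ≤ P.Psi σp σθ x := by
  refine mul_nonneg (sq_nonneg _) (le_trans ?_ (Finset.le_sup' _ (Finset.mem_univ 0)))
  exact Finset.sum_nonneg fun _ _ => by positivity

/-- The information on the headings after the positions have been marginalized out, before
fixing a pose. -/
noncomputable def headingInfo (σp σθ : ℝ) (x : Fin (N + 1) → Pose) :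
    Matrix (Fin (N + 1)) (Fin (N + 1)) ℝ :=
  (σθ ^ 2)⁻¹ • P.graph.lapMatrix ℝ + (σp ^ 2)⁻¹ • P.leverInfo x

theorem det_headingInfo_submatrix (σp σθ : ℝ) (x : Fin (N + 1) → Pose) (r : Fin (N + 1)) :
    ((P.headingInfo σp σθ x).submatrix Fin.succ Fin.succ).det =
      ((P.headingInfo σp σθ x).submatrix (Subtype.val : {i // i ≠ r} → _) Subtype.val).det := by
  rw [det_submatrix_succ]
  refine IsSymm.det_submatrix_ne_eq ?_ ?_ 0 r
  · have h1 : (P.leverInfo x).IsSymm := by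
      have h := (P.posSemidef_leverInfo x).1
      rwa [IsHermitian, conjTranspose_eq_transpose_of_trivial] at h
    exact ((SimpleGraph.isSymm_lapMatrix ℝ P.graph).smul _).add (h1.smul _)
  · have h1 : P.graph.lapMatrix ℝ *ᵥ 1 = 0 := P.graph.lapMatrix_mulVec_const_eq_zero
    rw [headingInfo, add_mulVec, smul_mulVec, smul_mulVec, h1, leverInfo_mulVec_one]
    simp

theorem card_ne (r : Fin (N + 1)) : Fintype.card {i // i ≠ r} = N := by
  simp [Fintype.card_subtype_compl]

variable {σp σθ : ℝ}

theorem det_headingInfo_ge (hp : 0 < σp) (hθ : 0 < σθ) (x : Fin (N + 1) → Pose) :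
    ((σθ ^ 2)⁻¹) ^ N * P.numSpanningTrees ≤
      ((P.headingInfo σp σθ x).submatrix Fin.succ Fin.succ).det := by
  rw [P.det_headingInfo_submatrix σp σθ x 0]
  have h1 : ((σθ ^ 2)⁻¹ • P.reducedLaplacian 0).PosDef :=
    (P.posDef_reducedLaplacian 0).smul (by positivity)
  have h2 : ((σp ^ 2)⁻¹ • (P.leverInfo x).submatrix (Subtype.val : {i // i ≠ (0 : Fin (N + 1))} → _)
      Subtype.val).PosSemidef := ((P.posSemidef_leverInfo x).submatrix _).smul (by positivity)
  have h3 := h1.det_le_det_add h2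
  rwa [det_smul, card_ne, det_reducedLaplacian] at h3

theorem det_headingInfo_le (hp : 0 < σp) (hθ : 0 < σθ) (x : Fin (N + 1) → Pose)
    (r : Fin (N + 1)) :
    ((P.headingInfo σp σθ x).submatrix Fin.succ Fin.succ).det ≤
      ((σθ ^ 2)⁻¹) ^ N * (P.reducedLaplacian r + P.Psi σp σθ x • 1).det := by
  rw [P.det_headingInfo_submatrix σp σθ x r]
  have h1 : ((P.headingInfo σp σθ x).submatrix (Subtype.val : {i // i ≠ r} → _)
      Subtype.val).PosDef := by
    have h1 : ((σθ ^ 2)⁻¹ • P.reducedLaplacian r).PosDef :=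
      (P.posDef_reducedLaplacian r).smul (by positivity)
    have h2 : ((σp ^ 2)⁻¹ • (P.leverInfo x).submatrix (Subtype.val : {i // i ≠ r} → _)
        Subtype.val).PosSemidef := ((P.posSemidef_leverInfo x).submatrix _).smul (by positivity)
    exact h1.add_posSemidef h2
  have h2 : ((σp ^ 2)⁻¹ • (P.distMaxSq x • (1 : Matrix _ _ ℝ) - P.leverInfo x).submatrix
      (Subtype.val : {i // i ≠ r} → _) Subtype.val).PosSemidef :=
    ((P.posSemidef_distMaxSq_sub_leverInfo x).submatrix _).smul (by positivity)
  have h3 := h1.det_le_det_add h2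
  -- The lever terms cancel; taking out `σθ⁻²` turns the coefficient `σp⁻²` into `(σθ / σp)²`, hence
  -- `Ψ`.
  have h4 : (P.headingInfo σp σθ x).submatrix (Subtype.val : {i // i ≠ r} → _) Subtype.val +
      (σp ^ 2)⁻¹ • (P.distMaxSq x • (1 : Matrix _ _ ℝ) - P.leverInfo x).submatrix
      (Subtype.val : {i // i ≠ r} → _) Subtype.val =
      (σθ ^ 2)⁻¹ • (P.reducedLaplacian r + P.Psi σp σθ x • 1) := by
    ext i j
    simp only [headingInfo, reducedLaplacian, Psi, Matrix.add_apply, Matrix.smul_apply,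
      Matrix.sub_apply, submatrix_apply, smul_eq_mul, one_apply, Subtype.ext_iff]
    field_simp
    ring
  rwa [h4, det_smul, card_ne] at h3

theorem det_infoMatrix_eq (hp : 0 < σp) (x : Fin (N + 1) → Pose) :
    (P.infoMatrix σp σθ x).det = ((σp ^ 2)⁻¹) ^ (2 * N) * (P.numSpanningTrees : ℝ) ^ 2 *
      ((P.headingInfo σp σθ x).submatrix Fin.succ Fin.succ).det := by
  rw [P.det_infoMatrix hp x, det_lapMatrix_submatrix_succ]
  · rfl
  · rw [det_lapMatrix_submatrix_succ]
    exact_mod_cast P.numSpanningTrees_pos.ne'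

theorem det_noiseInfo (σp σθ : ℝ) :
    (noiseInfo σp σθ).det = ((σp ^ 2)⁻¹) ^ 2 * (σθ ^ 2)⁻¹ := by
  rw [noiseInfo, det_diagonal, Fin.prod_univ_three]
  simp [sq]

theorem det_infoMatrix_ge (hp : 0 < σp) (hθ : 0 < σθ) (x : Fin (N + 1) → Pose) :
    (noiseInfo σp σθ).det ^ N * (P.numSpanningTrees : ℝ) ^ 3 ≤ (P.infoMatrix σp σθ x).det := by
  rw [P.det_infoMatrix_eq hp, det_noiseInfo, mul_pow, ← pow_mul]
  refine le_trans (le_of_eq ?_)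
    (mul_le_mul_of_nonneg_left (P.det_headingInfo_ge hp hθ x) (by positivity))
  ring

theorem det_infoMatrix_le (hp : 0 < σp) (hθ : 0 < σθ) (x : Fin (N + 1) → Pose)
    (r : Fin (N + 1)) :
    (P.infoMatrix σp σθ x).det ≤ (noiseInfo σp σθ).det ^ N * (P.numSpanningTrees : ℝ) ^ 2 *
      (P.reducedLaplacian r + P.Psi σp σθ x • 1).det := by
  rw [P.det_infoMatrix_eq hp, det_noiseInfo, mul_pow, ← pow_mul]
  refine le_trans
    (mul_le_mul_of_nonneg_left (P.det_headingInfo_le hp hθ x r) (by positivity)) (le_of_eq ?_)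
  ring

theorem det_noiseInfo_pos (hp : 0 < σp) (hθ : 0 < σθ) : 0 < (noiseInfo σp σθ).det := by
  rw [det_noiseInfo]
  positivity

theorem det_infoMatrix_pos (hp : 0 < σp) (hθ : 0 < σθ) (x : Fin (N + 1) → Pose) :
    0 < (P.infoMatrix σp σθ x).det := by
  refine lt_of_lt_of_le ?_ (P.det_infoMatrix_ge hp hθ x)
  have := det_noiseInfo_pos hp hθ
  have : (0 : ℝ) < P.numSpanningTrees := by exact_mod_cast P.numSpanningTrees_pos
  positivity

/-- A weighted Gram matrix is positive semidefinite, and the determinant bound excludes a kernel. -/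
theorem posDef_infoMatrix (hp : 0 < σp) (hθ : 0 < σθ) (x : Fin (N + 1) → Pose) :
    (P.infoMatrix σp σθ x).PosDef := by
  have h1 : (noiseInfo σp σθ).PosSemidef := by
    refine PosSemidef.diagonal fun i => ?_
    fin_cases i <;> simp <;> positivity
  have h2 := ((PosSemidef.one (n := {e // e ∈ P.meas}) (R := ℝ)).kronecker
    h1).conjTranspose_mul_mul_same (P.jacobian x)
  rw [conjTranspose_eq_transpose_of_trivial] at h2
  exact h2.posDef_iff_det_ne_zero.2 (P.det_infoMatrix_pos hp hθ x).ne'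

/-! ### The odometry-only information matrix. -/

/-- The odometry measurements, numbered by their first pose. -/
noncomputable def odometryEquiv (N : ℕ) : Fin N ≃ {e // e ∈ (odometryGraph N).meas} :=
  Equiv.ofBijective (fun i => ⟨(i.castSucc, i.succ), (odometryGraph N).odometry i⟩)
    ⟨fun i j h => Fin.castSucc_injective N (congrArg (fun e => e.1.1) h), fun e => by
      obtain ⟨i, -, hi⟩ := Finset.mem_image.1 e.2
      exact ⟨i, Subtype.ext hi⟩⟩

/-- The incidence matrix of the odometry path, without the initial pose. -/
noncomputable def odometryIncidence (N : ℕ) : Matrix (Fin N) (Fin N) ℝ :=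
  (odometryGraph N).incidence.submatrix (odometryEquiv N) Fin.succ

theorem det_odometryIncidence (N : ℕ) : (odometryIncidence N).det = 1 := by
  have happ : ∀ i j, odometryIncidence N i j =
      (if i.succ = j.succ then 1 else 0) - if i.castSucc = j.succ then 1 else 0 := fun _ _ => rfl
  rw [det_of_isLowerTriangular]
  · refine Finset.prod_eq_one fun i _ => ?_
    rw [happ, if_pos rfl, if_neg i.castSucc_lt_succ.ne, sub_zero]
  · intro i j hij
    have hij : i < j := hij
    have h1 : i.castSucc ≠ j.succ := by
      intro h
      have := congrArg Fin.val h
      simp only [Fin.val_castSucc, Fin.val_succ] at this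
      omega
    rw [happ, if_neg fun h => hij.ne (Fin.succ_injective N h), if_neg h1, sub_zero]

theorem odometryIncidence_submatrix (N : ℕ) :
    (odometryGraph N).incidence.submatrix id Fin.succ =
      (odometryIncidence N).submatrix (odometryEquiv N).symm id := by
  ext e k
  simp [odometryIncidence]

theorem lapMatrix_odometryGraph_submatrix (N : ℕ) :
    ((odometryGraph N).graph.lapMatrix ℝ).submatrix Fin.succ Fin.succ =
      (odometryIncidence N)ᵀ * odometryIncidence N := by
  rw [← incidence_transpose_mul_self]
  change ((odometryGraph N).incidence.submatrix id Fin.succ)ᵀ *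
    (odometryGraph N).incidence.submatrix id Fin.succ = _
  rw [odometryIncidence_submatrix, transpose_submatrix, submatrix_mul_equiv, submatrix_id_id]

/-- There are as many odometry measurements as unknown poses, so the position Jacobian has a right
inverse and its residual projection vanishes. -/
theorem leverInfo_odometryGraph (x : Fin (N + 1) → Pose) : (odometryGraph N).leverInfo x = 0 := by
  have h1 : (odometryGraph N).incidence.submatrix id Fin.succ *
      (odometryIncidence N)⁻¹.submatrix id (odometryEquiv N).symm = 1 := by
    rw [odometryIncidence_submatrix, ← submatrix_mul _ _ _ _ _ Function.bijective_id,
      mul_nonsing_inv _ (by rw [det_odometryIncidence]; exact isUnit_one), submatrix_one_equiv]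
  have h2 : (odometryGraph N).posJacobian *
      ((odometryIncidence N)⁻¹.submatrix id (odometryEquiv N).symm ⊗ₖ
        (1 : Matrix (Fin 2) (Fin 2) ℝ)) = 1 := by
    rw [posJacobian, ← mul_kronecker_mul, h1, Matrix.one_mul, one_kronecker_one]
  have h3 : colResidual (odometryGraph N).posJacobian = 0 := by
    rw [← Matrix.mul_one (colResidual _), ← h2, ← Matrix.mul_assoc,
      colResidual_mul (odometryGraph N).det_posJacobian_transpose_mul_self_ne_zero,
      Matrix.zero_mul]
  rw [leverInfo, h3, Matrix.mul_zero, Matrix.zero_mul]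

theorem det_infoMatrix_odometryGraph (hp : 0 < σp) (x : Fin (N + 1) → Pose) :
    ((odometryGraph N).infoMatrix σp σθ x).det = (noiseInfo σp σθ).det ^ N := by
  have h1 : (((odometryGraph N).graph.lapMatrix ℝ).submatrix Fin.succ Fin.succ).det = 1 := by
    rw [lapMatrix_odometryGraph_submatrix, det_mul, det_transpose, det_odometryIncidence, mul_one]
  rw [det_infoMatrix _ hp x (by rw [h1]; exact one_ne_zero), leverInfo_odometryGraph, smul_zero,
    add_zero, submatrix_smul]
  change _ * _ * ((σθ ^ 2)⁻¹ • (_ : Matrix (Fin N) (Fin N) ℝ)).det = _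
  rw [det_smul, h1, det_noiseInfo, mul_pow, ← pow_mul]
  simp

/-! ### From determinants to entropy. -/

theorem entropy_eq (x : Fin (N + 1) → Pose) :
    P.entropy σp σθ x = (3 * N : ℝ) / 2 * Real.log (2 * Real.pi * Real.exp 1) -
      1 / 2 * Real.log (P.infoMatrix σp σθ x).det := by
  rw [entropy, det_nonsing_inv, Ring.inverse_eq_inv', Real.log_inv]
  ring

theorem log_det_infoMatrix_ge (hp : 0 < σp) (hθ : 0 < σθ) (x : Fin (N + 1) → Pose) :
    3 * P.tau + N * Real.log (noiseInfo σp σθ).det ≤ Real.log (P.infoMatrix σp σθ x).det := by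
  have h1 := det_noiseInfo_pos hp hθ
  have h2 : (0 : ℝ) < P.numSpanningTrees := by exact_mod_cast P.numSpanningTrees_pos
  have h3 := Real.log_le_log (by positivity) (P.det_infoMatrix_ge hp hθ x)
  rw [Real.log_mul (by positivity) (by positivity), Real.log_pow, Real.log_pow] at h3
  rw [tau]
  push_cast at h3
  linarith

theorem posDef_reducedLaplacian_add_Psi (x : Fin (N + 1) → Pose) (r : Fin (N + 1)) :
    (P.reducedLaplacian r + P.Psi σp σθ x • 1).PosDef :=
  (P.posDef_reducedLaplacian r).add_posSemidef (PosSemidef.one.smul (P.Psi_nonneg σp σθ x))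

theorem log_det_infoMatrix_le (hp : 0 < σp) (hθ : 0 < σθ) (x : Fin (N + 1) → Pose)
    (r : Fin (N + 1)) :
    Real.log (P.infoMatrix σp σθ x).det ≤ 2 * P.tau + N * Real.log (noiseInfo σp σθ).det +
      Real.log (P.reducedLaplacian r + P.Psi σp σθ x • 1).det := by
  have h1 := det_noiseInfo_pos hp hθ
  have h2 : (0 : ℝ) < P.numSpanningTrees := by exact_mod_cast P.numSpanningTrees_pos
  have h3 := Real.log_le_log (P.det_infoMatrix_pos hp hθ x) (P.det_infoMatrix_le hp hθ x r)
  rw [Real.log_mul (by positivity) (P.posDef_reducedLaplacian_add_Psi x r).det_pos.ne',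
    Real.log_mul (by positivity) (by positivity), Real.log_pow, Real.log_pow] at h3
  rw [tau]
  push_cast at h3
  linarith

theorem log_det_one_add_Psi_smul_inv (x : Fin (N + 1) → Pose) (r : Fin (N + 1)) :
    Real.log (1 + P.Psi σp σθ x • (P.reducedLaplacian r)⁻¹).det =
      Real.log (P.reducedLaplacian r + P.Psi σp σθ x • 1).det -
        Real.log (P.reducedLaplacian r).det := by
  have h1 := (P.posDef_reducedLaplacian r).det_pos
  have h2 := (P.posDef_reducedLaplacian_add_Psi (σp := σp) (σθ := σθ) x r).det_pos
  have h3 : P.reducedLaplacian r + P.Psi σp σθ x • 1 =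
      P.reducedLaplacian r * (1 + P.Psi σp σθ x • (P.reducedLaplacian r)⁻¹) := by
    rw [Matrix.mul_add, Matrix.mul_one, Matrix.mul_smul, mul_nonsing_inv _ h1.ne'.isUnit]
  rw [h3, det_mul] at h2 ⊢
  rw [Real.log_mul h1.ne' (right_ne_zero_of_mul h2.ne')]
  ring

theorem neg_sST (σp σθ : ℝ) : - P.sST σp σθ =
    (N * 3 : ℝ) / 2 * Real.log (2 * Real.pi * Real.exp 1)
      - 1 / 2 * (3 * P.tau + N * Real.log (noiseInfo σp σθ).det) := by
  rw [sST, Real.log_pow]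
  push_cast
  ring

end PoseSLAM.PoseGraph

/-- Bounds on the posterior entropy of planar pose SLAM with isotropic relative-pose noise. -/
theorem mainTheorem2 (N : ℕ) (P : PoseSLAM.PoseGraph N) (σp σθ : ℝ) (hp : 0 < σp) (hθ : 0 < σθ)
    (x : Fin (N + 1) → PoseSLAM.Pose) :
    (P.infoMatrix σp σθ x).PosDef ∧
    Real.log ((PoseSLAM.odometryGraph N).infoMatrix σp σθ x).det
      = N * Real.log (PoseSLAM.noiseInfo σp σθ).det ∧
    P.entropy σp σθ x ≤
      (N * 3 : ℝ) / 2 * Real.log (2 * Real.pi * Real.exp 1)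
        - 1 / 2 * (3 * P.tau + N * Real.log (PoseSLAM.noiseInfo σp σθ).det) ∧
    (N * 3 : ℝ) / 2 * Real.log (2 * Real.pi * Real.exp 1)
        - 1 / 2 * (3 * P.tau + N * Real.log (PoseSLAM.noiseInfo σp σθ).det)
      = - P.sST σp σθ ∧
    ∀ r : Fin (N + 1),
      (P.reducedLaplacian r).PosDef ∧
      (P.numSpanningTrees : ℝ) = (P.reducedLaplacian r).det ∧
      - P.sST σp σθ
          - 1 / 2 * Real.log (P.reducedLaplacian r + P.Psi σp σθ x • 1).det + 1 / 2 * P.tau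
        ≤ P.entropy σp σθ x ∧
      - P.sST σp σθ
          - 1 / 2 * Real.log (P.reducedLaplacian r + P.Psi σp σθ x • 1).det + 1 / 2 * P.tau
        = - P.sST σp σθ
          - 1 / 2 * (Real.log (P.reducedLaplacian r + P.Psi σp σθ x • 1).det
            - Real.log (P.reducedLaplacian r).det) ∧
      - P.sST σp σθ
          - 1 / 2 * (Real.log (P.reducedLaplacian r + P.Psi σp σθ x • 1).det
            - Real.log (P.reducedLaplacian r).det)
        = - P.sST σp σθ
          - 1 / 2 * Real.log (1 + P.Psi σp σθ x • (P.reducedLaplacian r)⁻¹).det := by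
  have hge := P.log_det_infoMatrix_ge hp hθ x
  have hent := P.entropy_eq (σp := σp) (σθ := σθ) x
  have hsST := P.neg_sST σp σθ
  refine ⟨P.posDef_infoMatrix hp hθ x, ?_, ?_, hsST.symm, fun r =>
    ⟨P.posDef_reducedLaplacian r, (P.det_reducedLaplacian r).symm, ?_, ?_, ?_⟩⟩
  · rw [PoseSLAM.PoseGraph.det_infoMatrix_odometryGraph hp, Real.log_pow]
  · rw [hent]
    linarith
  -- The upper bound on the log-determinant contains `2τ` where `-s_ST` accounts for `3τ`; the
  -- difference is the correction `+τ/2`.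
  · have hle := P.log_det_infoMatrix_le hp hθ x r
    rw [hent, hsST]
    linarith
  · rw [P.det_reducedLaplacian r, PoseSLAM.PoseGraph.tau]
    ring
  · rw [P.log_det_one_add_Psi_smul_inv]
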